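/- For $n\ge 0$ let $\mathcal{Q}_n$ denote the Boolean lattice of dimension $n$, i.e. the power set of $\{1,\dots,n\}$ ordered by inclusion. For posets $P_1,P_2$, the weak poset Ramsey number $R_w(P_1,P_2)$ is the smallest integer $N$ such that for every coloring of the elements of $\mathcal{Q}_N$ with the colors blue and red there is an order-preserving injection $P_1\to\mathcal{Q}_N$ all of whose values are blue, or an order-preserving injection $P_2\to\mathcal{Q}_N$ all of whose values are red. (An injection $f$ is order-preserving if $x\le y$ implies $f(x)\le f(y)$.) Then, for all integers $m\ge 2$ and $n\ge 68$, $$R_w(\mathcal{Q}_m,\mathcal{Q}_n)\ \ge\ m+n+1 .$$ Moreover, for every integer $n\ge 68$, $$R_w(\mathcal{Q}_2,\mathcal{Q}_n)=n+3 .$$ -/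

import Mathlib

namespace PosetRamsey

/-- The Boolean lattice of dimension `n`: the power set of an `n`-element set, ordered by inclusion
(on `Finset`, the relation `≤` is `⊆`). -/
abbrev BooleanLattice (n : ℕ) : Type := Finset (Fin n)

/-- The family `F` of elements of the poset `Q` contains a weak copy of the poset `P`: there is an
order-preserving injection from `P` to `Q` whose image lies in `F`. -/
def ContainsWeakCopy (P : Type*) {Q : Type*} [PartialOrder P] [PartialOrder Q] (F : Set Q) : Prop :=
  ∃ f : P → Q, Function.Injective f ∧ (∀ x y : P, x ≤ y → f x ≤ f y) ∧ ∀ x : P, f x ∈ F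

/-- The two colors. -/
inductive Color : Type
  | blue : Color
  | red : Color

/-- Every blue-red coloring of the elements of the Boolean lattice of dimension `N` contains a weak
copy of `P₁` all of whose elements are blue or a weak copy of `P₂` all of whose elements are red. -/
def WeakArrows (P₁ P₂ : Type*) [PartialOrder P₁] [PartialOrder P₂] (N : ℕ) : Prop :=
  ∀ c : BooleanLattice N → Color,
    ContainsWeakCopy P₁ {A | c A = Color.blue} ∨ ContainsWeakCopy P₂ {A | c A = Color.red}

/-- The weak poset Ramsey number `R_w(P₁, P₂)`: the smallest `N` such that every blue-red coloring
of the Boolean lattice of dimension `N` contains a blue weak copy of `P₁` or a red weak copy of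
`P₂`. (The value would be `0` if there were no such `N`; so a positive lower bound on it includes
the existence of such an `N`.) -/
noncomputable def weakRamseyNumber (P₁ P₂ : Type*) [PartialOrder P₁] [PartialOrder P₂] : ℕ :=
  sInf {N : ℕ | WeakArrows P₁ P₂ N}

end PosetRamsey

namespace PosetRamsey

open Finset

/-! ### Basic properties of the arrow relation -/

/-! Upper bound: send `S` to `S` plus the first `h S` of `k` extra points, where `h S` is the length
of the longest blue chain of a fixed shape below `S`. Maximality makes these sets red unless some
chain reaches `k + 1` elements, enough for any poset of that size (`weakArrows_of_card_le`). Lower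
bound, for `m ≤ n`: color by layers so that blue meets `m + 1` layers and red `n + 1`. A copy of
either lattice then has no room, and its ranks are forced (`eq_card_of_strictMono`). Both colors
share only layer `m + 1`, split by the sum modulo `m + n`. The `m` coatoms of a blue copy would need
distinct sums, but only `m - 1` are available. In a red copy, most pairs of atoms map to `A ∪ {φ i,
φ j, e}` with `A`, `e` fixed (`exists_pairs_of_weakCopy_red`), and by `exists_ne_add_val_lt_pred`
some such set has a blue sum. -/

theorem WeakArrows.mono {P₁ P₂ : Type*} [PartialOrder P₁] [PartialOrder P₂] {M N : ℕ}
    (hMN : M ≤ N) (h : WeakArrows P₁ P₂ M) : WeakArrows P₁ P₂ N := by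
  intro c
  let e : Fin M ↪ Fin N := (Fin.castLEEmb hMN)
  rcases h (fun A => c (A.map e)) with ⟨f, hinj, hmono, hf⟩ | ⟨f, hinj, hmono, hf⟩
  · exact Or.inl ⟨fun x => (f x).map e, fun x y hxy => hinj (Finset.map_injective e hxy),
      fun x y hxy => Finset.map_subset_map.2 (hmono x y hxy), hf⟩
  · exact Or.inr ⟨fun x => (f x).map e, fun x y hxy => hinj (Finset.map_injective e hxy),
      fun x y hxy => Finset.map_subset_map.2 (hmono x y hxy), hf⟩

theorem WeakArrows.symm {P₁ P₂ : Type*} [PartialOrder P₁] [PartialOrder P₂] {N : ℕ}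
    (h : WeakArrows P₁ P₂ N) : WeakArrows P₂ P₁ N := by
  intro c
  have h' := h fun A => match c A with
    | Color.blue => Color.red
    | Color.red => Color.blue
  have hb : ∀ A, (match c A with
      | Color.blue => Color.red
      | Color.red => Color.blue) = Color.blue ↔ c A = Color.red := by
    intro A; cases c A <;> simp
  have hr : ∀ A, (match c A with
      | Color.blue => Color.red
      | Color.red => Color.blue) = Color.red ↔ c A = Color.blue := by
    intro A; cases c A <;> simp
  simp only [hb, hr] at h'
  exact h'.symm

/-- A chain as long as a finite poset contains a weak copy of it. -/
theorem containsWeakCopy_of_chain {P Q : Type*} [PartialOrder P] [PartialOrder Q] [Fintype P]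
    {F : Set Q} {k : ℕ} (hk : Fintype.card P ≤ k) (g : ℕ → Q)
    (hg : ∀ i j, i < j → j < k → g i < g j) (hF : ∀ i, i < k → g i ∈ F) :
    ContainsWeakCopy P F := by
  classical
  let _ : Fintype (LinearExtension P) := inferInstanceAs (Fintype P)
  let e : LinearExtension P ≃o Fin (Fintype.card P) :=
    (monoEquivOfFin (LinearExtension P) (k := Fintype.card P) rfl).symm
  have hlt : ∀ x, (e x : ℕ) < k := fun x => (e x).2.trans_le hk
  have hle : ∀ i j, i ≤ j → j < k → g i ≤ g j := by
    intro i j hij hj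
    rcases hij.eq_or_lt with rfl | h
    · exact le_rfl
    · exact (hg i j h hj).le
  refine ⟨fun x => g (e (toLinearExtension x)), ?_, ?_, fun x => hF _ (hlt _)⟩
  · intro x y hxy
    have hxy' : g (e (toLinearExtension x)) = g (e (toLinearExtension y)) := hxy
    have : (e (toLinearExtension x) : ℕ) = e (toLinearExtension y) := by
      rcases lt_trichotomy (e (toLinearExtension x) : ℕ) (e (toLinearExtension y)) with h | h | h
      · exact absurd hxy' (hg _ _ h (hlt _)).ne
      · exact h
      · exact absurd hxy' (hg _ _ h (hlt _)).ne'
    exact e.injective (Fin.ext this)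
  · intro x y hxy
    exact hle _ _ (e.monotone (toLinearExtension.monotone hxy)) (hlt _)

/-! ### The upper bound -/

/-- The set `S` of the first `n` elements together with the first `i` of the last `k` elements. -/
def extendBy (n k : ℕ) (S : Finset (Fin n)) (i : ℕ) : Finset (Fin (n + k)) :=
  S.map (Fin.castAddEmb k) ∪ (univ.filter fun j : Fin k => (j : ℕ) < i).map (Fin.natAddEmb n)

theorem castAdd_mem_extendBy {n k : ℕ} {S : Finset (Fin n)} {i : ℕ} {x : Fin n} :
    Fin.castAdd k x ∈ extendBy n k S i ↔ x ∈ S := by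
  simp only [extendBy, mem_union, mem_map, mem_filter, mem_univ, true_and]
  constructor
  · rintro (⟨y, hy, h⟩ | ⟨y, -, h⟩)
    · have : y = x := by simpa [Fin.ext_iff] using h
      exact this ▸ hy
    · have h1 := congrArg Fin.val h
      have := x.2
      simp at h1
      omega
  · exact fun h => Or.inl ⟨x, h, rfl⟩

theorem natAdd_mem_extendBy {n k : ℕ} {S : Finset (Fin n)} {i : ℕ} {x : Fin k} :
    Fin.natAdd n x ∈ extendBy n k S i ↔ (x : ℕ) < i := by
  simp only [extendBy, mem_union, mem_map, mem_filter, mem_univ, true_and]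
  constructor
  · rintro (⟨y, hy, h⟩ | ⟨y, hy, h⟩)
    · have h1 := congrArg Fin.val h
      have := y.2
      simp at h1
      omega
    · have : y = x := by simpa [Fin.ext_iff] using h
      exact this ▸ hy
  · exact fun h => Or.inr ⟨x, h, rfl⟩

theorem extendBy_mono {n k : ℕ} {S T : Finset (Fin n)} {i j : ℕ} (hST : S ⊆ T) (hij : i ≤ j) :
    extendBy n k S i ⊆ extendBy n k T j := by
  intro x
  induction x using Fin.addCases with
  | left x => simpa only [castAdd_mem_extendBy] using fun h => hST h
  | right x => simpa only [natAdd_mem_extendBy] using fun h => lt_of_lt_of_le h hij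

theorem extendBy_left_injective {n k : ℕ} {S T : Finset (Fin n)} {i j : ℕ}
    (h : extendBy n k S i = extendBy n k T j) : S = T := by
  ext x
  rw [← castAdd_mem_extendBy (k := k) (i := i), h, castAdd_mem_extendBy]

theorem extendBy_lt {n k : ℕ} {S T : Finset (Fin n)} {i j : ℕ} (hST : S ⊆ T) (hij : i < j)
    (hi : i < k) : extendBy n k S i < extendBy n k T j := by
  refine lt_of_le_of_ne (extendBy_mono hST hij.le) fun h => ?_
  have h1 : Fin.natAdd n (⟨i, hi⟩ : Fin k) ∈ extendBy n k T j := natAdd_mem_extendBy.2 hij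
  rw [← h, natAdd_mem_extendBy] at h1
  exact lt_irrefl _ h1

/-- Every coloring of the Boolean lattice of dimension `n + k` has a blue chain of `k + 1` elements
or a red weak copy of the Boolean lattice of dimension `n`. -/
theorem weakArrows_of_card_le {P : Type*} [PartialOrder P] [Fintype P] (n k : ℕ)
    (hk : Fintype.card P ≤ k + 1) : WeakArrows P (BooleanLattice n) (n + k) := by
  classical
  intro c
  -- A blue chain of length `l` below `S` whose `j`-th member contains exactly `j` of the last `k`
  -- points.
  let R : Finset (Fin n) → ℕ → Prop := fun S l =>
    ∃ t : ℕ → Finset (Fin n), Monotone t ∧ ∀ j < l, t j ⊆ S ∧ c (extendBy n k (t j) j) = Color.blue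
  by_cases hR : ∃ S, R S (k + 1)
  · left
    obtain ⟨S, t, ht, hS⟩ := hR
    exact containsWeakCopy_of_chain hk (fun i => extendBy n k (t i) i)
      (fun i j hij hj => extendBy_lt (ht hij.le) hij (by omega)) fun i hi => (hS i hi).2
  · right
    push Not at hR
    let h : Finset (Fin n) → ℕ := fun S => Nat.findGreatest (R S) (k + 1)
    have hspec : ∀ S, R S (h S) := fun S =>
      Nat.findGreatest_spec (P := R S) (Nat.zero_le _)
        ⟨fun _ => ∅, monotone_const, fun j hj => absurd hj (Nat.not_lt_zero j)⟩
    have hle : ∀ S, h S ≤ k + 1 := fun S => Nat.findGreatest_le _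
    have hlt : ∀ S, h S < k + 1 := fun S =>
      lt_of_le_of_ne (hle S) fun e => hR S (e ▸ hspec S)
    have hmono : ∀ S T, S ⊆ T → h S ≤ h T := by
      intro S T hST
      obtain ⟨t, ht, hS⟩ := hspec S
      exact Nat.le_findGreatest (hle S) ⟨t, ht, fun j hj => ⟨(hS j hj).1.trans hST, (hS j hj).2⟩⟩
    refine ⟨fun S => extendBy n k S (h S), fun S T hST => extendBy_left_injective hST,
      fun S T hST => extendBy_mono hST (hmono S T hST), fun S => ?_⟩
    show c (extendBy n k S (h S)) = Color.red
    cases hc : c (extendBy n k S (h S)) with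
    | red => rfl
    | blue =>
      exfalso
      obtain ⟨t, ht, hS⟩ := hspec S
      -- If the image of `S` were blue, it would prolong the longest chain.
      have : R S (h S + 1) := by
        refine ⟨fun j => if j < h S then t j else S, ?_, ?_⟩
        · intro i j hij
          by_cases hj : j < h S
          · simp only [hj, lt_of_le_of_lt hij hj, if_true]
            exact ht hij
          · by_cases hi : i < h S
            · simp only [hi, hj, if_true, if_false]
              exact (hS i hi).1
            · simp only [hi, hj, if_false]
              exact le_rfl
        · intro j hj
          by_cases hj' : j < h S
          · simpa only [hj', if_true] using hS j hj'
          · obtain rfl : j = h S := by omega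
            simpa using hc
      have := Nat.le_findGreatest (hlt S) this
      exact absurd this (Nat.not_succ_le_self _)

theorem weakArrows_booleanLattice (m n : ℕ) :
    WeakArrows (BooleanLattice m) (BooleanLattice n) (n + (2 ^ m - 1)) :=
  weakArrows_of_card_le n _ (by
    rw [Fintype.card_finset, Fintype.card_fin, Nat.sub_add_cancel Nat.one_le_two_pow])

/-! ### Sums of two elements in a cyclic group -/

theorem card_filter_add_self_eq_le_two {N : ℕ} [NeZero N] (k : ZMod N) :
    #{y : ZMod N | y + y = k} ≤ 2 := by
  have hsub : ({y : ZMod N | y + y = k} : Finset (ZMod N)) ⊆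
      {((k.val / 2 : ℕ) : ZMod N), (((k.val + N) / 2 : ℕ) : ZMod N)} := by
    intro y hy
    simp only [mem_filter, mem_univ, true_and] at hy
    have hv : (y.val + y.val) % N = k.val := by rw [← ZMod.val_add, hy]
    have hy' := ZMod.val_lt y
    rw [mem_insert, mem_singleton]
    rcases lt_or_ge (y.val + y.val) N with h | h
    · left
      rw [Nat.mod_eq_of_lt h] at hv
      rw [show k.val / 2 = y.val by omega, ZMod.natCast_zmod_val]
    · right
      rw [Nat.mod_eq_sub_mod h, Nat.mod_eq_of_lt (by omega)] at hv
      rw [show (k.val + N) / 2 = y.val by omega, ZMod.natCast_zmod_val]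
  exact (card_le_card hsub).trans card_le_two

/-- `Y` and its reflection `-c - Y` overlap in at least three elements, and at most two of them are
fixed by the reflection. -/
theorem exists_ne_add_eq {N : ℕ} [NeZero N] (Y : Finset (ZMod N)) (hY : N + 3 ≤ 2 * #Y)
    (c : ZMod N) : ∃ y ∈ Y, ∃ z ∈ Y, y ≠ z ∧ c + y + z = 0 := by
  classical
  let Z := Y.image fun y => -c - y
  have hZ : #Z = #Y := card_image_of_injective _ fun a b h => by simpa using h
  have hu : #(Y ∪ Z) ≤ N := (card_le_univ _).trans (ZMod.card N).le
  have hi := card_union_add_card_inter Y Z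
  have h2 := card_filter_add_self_eq_le_two (-c)
  obtain ⟨y, hy, hyn⟩ := exists_mem_notMem_of_card_lt_card
    (show #{y : ZMod N | y + y = -c} < #(Y ∩ Z) by omega)
  rw [mem_inter, mem_image] at hy
  obtain ⟨hyY, z, hz, hzy⟩ := hy
  refine ⟨y, hyY, z, hz, ?_, by rw [← hzy]; ring⟩
  rintro rfl
  apply hyn
  simp only [mem_filter, mem_univ, true_and]
  nth_rewrite 1 [← hzy]
  ring

theorem card_image_natCast_zmod {N : ℕ} (S : Finset ℕ) (hS : ∀ x ∈ S, x < N) :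
    #(S.image fun x : ℕ => (x : ZMod N)) = #S := by
  apply card_image_of_injOn
  intro x hx y hy h
  have h' : (x : ZMod N) = y := h
  rw [ZMod.natCast_eq_natCast_iff'] at h'
  rwa [Nat.mod_eq_of_lt (hS x hx), Nat.mod_eq_of_lt (hS y hy)] at h'

/-- Two translates of an interval of length `t` that are shifted by at least `6` cover `t + 6`
elements of a cyclic group. -/
theorem le_card_interval_union_shift {N t : ℕ} [NeZero N] (ht : 6 ≤ t) (htN : t + 6 ≤ N)
    (d : ZMod N) (hd : 6 ≤ (-d).val) (hdN : (-d).val + 6 ≤ N) :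
    t + 6 ≤ #{w : ZMod N | w.val < t ∨ (w + d).val < t} := by
  set ε := (-d).val with hε
  -- Six residues beyond `[0, t)` that lie in the shifted interval `[ε, ε + t)` and do not wrap
  -- around.
  let s := max t ε
  let S := range t ∪ Ico s (s + 6)
  have hcard : #S = t + 6 := by
    rw [card_union_of_disjoint, card_range, Nat.card_Ico]
    · omega
    · rw [Finset.disjoint_left]
      intro x hx hx'
      rw [mem_range] at hx
      rw [mem_Ico] at hx'
      omega
  have hSN : ∀ x ∈ S, x < N := by
    intro x hx
    simp only [S, mem_union, mem_range, mem_Ico] at hx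
    omega
  rw [← hcard, ← card_image_natCast_zmod S hSN]
  apply card_le_card
  intro w hw
  obtain ⟨x, hx, rfl⟩ := mem_image.1 hw
  simp only [mem_filter, mem_univ, true_and]
  have hxN := hSN x hx
  simp only [S, mem_union, mem_range, mem_Ico] at hx
  rcases hx with hx | hx
  · left
    rwa [ZMod.val_cast_of_lt hxN]
  · right
    have hxε : ε ≤ x := by omega
    have hd' : d = -(ε : ZMod N) := by rw [hε, ZMod.natCast_zmod_val, neg_neg]
    have : (x : ZMod N) + d = ((x - ε : ℕ) : ZMod N) := by
      rw [hd', Nat.cast_sub hxε, sub_eq_add_neg]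
    rw [this, ZMod.val_cast_of_lt (by omega)]
    omega

/-- At most 11 residues are within cyclic distance 5 of `y`. -/
theorem exists_far {N : ℕ} [NeZero N] (Y : Finset (ZMod N)) (hY : 12 ≤ #Y) (y : ZMod N) :
    ∃ z ∈ Y, 6 ≤ (y - z).val ∧ (y - z).val + 6 ≤ N := by
  classical
  by_contra! h
  let S := range 6 ∪ Ico (N - 5) N
  have hsub : Y.image (fun z => (y - z).val) ⊆ S := by
    intro x hx
    obtain ⟨z, hz, rfl⟩ := mem_image.1 hx
    have h1 := h z hz
    have h2 := ZMod.val_lt (y - z)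
    simp only [S, mem_union, mem_range, mem_Ico]
    omega
  have h1 := card_le_card hsub
  rw [card_image_of_injective] at h1
  · have h2 : #S ≤ 6 + (N - (N - 5)) := by
      simpa using card_union_le (range 6) (Ico (N - 5) N)
    omega
  · intro a b hab
    simpa using ZMod.val_injective N hab

/-- Fix far-apart `y`, `y'` in `Y`. The sums `c + y + z` for which `y` or `y'` works with `z` fill
at least `t + 6` residues. At least `#Y - 2` sums come from other `z ∈ Y`, so the two sets meet. -/
theorem exists_ne_add_val_lt {N t : ℕ} [NeZero N] (Y : Finset (ZMod N)) (hY : 12 ≤ #Y)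
    (ht : 6 ≤ t) (htN : t + 6 ≤ N) (htY : N + 3 ≤ #Y + (t + 6)) (c : ZMod N) :
    ∃ y ∈ Y, ∃ z ∈ Y, y ≠ z ∧ (c + y + z).val < t := by
  classical
  obtain ⟨y, hy⟩ : Y.Nonempty := card_pos.1 (by omega)
  obtain ⟨y', hy', h1, h2⟩ := exists_far Y hY y
  let W : Finset (ZMod N) := {w | w.val < t ∨ (w + (y' - y)).val < t}
  have hW : t + 6 ≤ #W := by
    apply le_card_interval_union_shift ht htN <;> rwa [neg_sub]
  let Z := (Y \ {y, y'}).image fun z => c + y + z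
  have hZ : #Y ≤ #Z + 2 := by
    rw [card_image_of_injective _ (add_right_injective _)]
    have := le_card_sdiff {y, y'} Y
    have : #({y, y'} : Finset (ZMod N)) ≤ 2 := card_le_two
    omega
  have hu : #(W ∪ Z) ≤ N := (card_le_univ _).trans (ZMod.card N).le
  have hi := card_union_add_card_inter W Z
  obtain ⟨w, hw⟩ : (W ∩ Z).Nonempty := card_pos.1 (by omega)
  rw [mem_inter, mem_image] at hw
  obtain ⟨hwW, z, hz, rfl⟩ := hw
  simp only [mem_sdiff, mem_insert, mem_singleton, not_or] at hz
  simp only [W, mem_filter, mem_univ, true_and] at hwW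
  rcases hwW with h | h
  · exact ⟨y, hy, z, hz.1, Ne.symm hz.2.1, h⟩
  · refine ⟨y', hy', z, hz.1, Ne.symm hz.2.2, ?_⟩
    rwa [show c + y' + z = c + y + z + (y' - y) by ring]

theorem exists_ne_add_val_lt_pred {m n : ℕ} [NeZero (m + n)] (hm : 2 ≤ m) (hmn : m ≤ n)
    (hn : 68 ≤ n) (Y : Finset (ZMod (m + n))) (hY : n ≤ #Y + 2) (c : ZMod (m + n)) :
    ∃ y ∈ Y, ∃ z ∈ Y, y ≠ z ∧ (c + y + z).val < m - 1 := by
  -- If `n` is well above `m`, `Y` exceeds half the group and the sum 0 is attained; otherwise the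
  -- interval is long.
  by_cases h : m + 7 ≤ n
  · obtain ⟨y, hy, z, hz, hyz, h0⟩ := exists_ne_add_eq Y (by omega) c
    exact ⟨y, hy, z, hz, hyz, by rw [h0, ZMod.val_zero]; omega⟩
  · exact exists_ne_add_val_lt Y (by omega) (by omega) (by omega) (by omega) c

/-! ### The coloring for the lower bound -/

/-- Strict growth from the bottom gives `#S ≤ h S`; strict descent from the top gives the reverse.
-/
theorem eq_card_of_strictMono {n : ℕ} {h : Finset (Fin n) → ℕ} (hmono : StrictMono h)
    (hle : ∀ S, h S ≤ n) (S : Finset (Fin n)) : h S = #S := by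
  classical
  have h1 : ∀ S : Finset (Fin n), #S ≤ h S := by
    intro S
    induction S using Finset.induction_on with
    | empty => simp
    | insert a S ha ih =>
      rw [card_insert_of_notMem ha]
      exact ih.trans_lt (hmono (ssubset_insert ha))
  have h2 : ∀ U : Finset (Fin n), h Uᶜ + #U ≤ n := by
    intro U
    induction U using Finset.induction_on with
    | empty => simpa using hle univ
    | insert a U ha ih =>
      rw [card_insert_of_notMem ha]
      have : h (insert a U)ᶜ < h Uᶜ := hmono (compl_ssubset_compl.2 (ssubset_insert ha))
      omega
  have h3 := h2 Sᶜ
  have h4 := h1 S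
  have h5 := card_add_card_compl S
  rw [compl_compl] at h3
  rw [Fintype.card_fin] at h5
  omega

/-- The sum modulo `N` of the elements of a set. -/
def residueSum {N : ℕ} (A : Finset (Fin N)) : ZMod N := ∑ i ∈ A, ((i : ℕ) : ZMod N)

theorem natCast_fin_injective (N : ℕ) : Function.Injective fun i : Fin N => ((i : ℕ) : ZMod N) := by
  intro i j h
  have h' : ((i : ℕ) : ZMod N) = (j : ℕ) := h
  rw [ZMod.natCast_eq_natCast_iff', Nat.mod_eq_of_lt i.2, Nat.mod_eq_of_lt j.2] at h'
  exact Fin.ext h'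

theorem residueSum_insert {N : ℕ} {A : Finset (Fin N)} {x : Fin N} (hx : x ∉ A) :
    residueSum (insert x A) = ((x : ℕ) : ZMod N) + residueSum A := sum_insert hx

/-- The blue sets: the layers `0, …, m - 3`, the layers `m` and `m + 3`, and the sets of the layer
`m + 1` whose sum modulo `m + n` is one of `m - 1` consecutive residues. -/
def IsBlueSet (m n : ℕ) (A : Finset (Fin (m + n))) : Prop :=
  #A + 2 < m ∨ #A = m ∨ #A = m + 3 ∨ (#A = m + 1 ∧ (residueSum A).val < m - 1)

theorem not_containsWeakCopy_blue {m n : ℕ} (hm : 2 ≤ m) :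
    ¬ ContainsWeakCopy (BooleanLattice m) {A | IsBlueSet m n A} := by
  classical
  rintro ⟨f, hinj, hmono, hf⟩
  have hNZ : NeZero (m + n) := ⟨by omega⟩
  have hblue : ∀ S, IsBlueSet m n (f S) := hf
  -- Numbers the layers meeting blue, `0, …, m - 3, m, m + 1, m + 3`, from `0` to `m`.
  let r : ℕ → ℕ := fun s =>
    if s + 2 < m then s else if s = m then m - 2 else if s = m + 1 then m - 1 else m
  have hr : ∀ S, r #(f S) = #S := by
    refine eq_card_of_strictMono (h := fun S => r #(f S)) ?_ ?_
    · intro S T hST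
      have hlt : #(f S) < #(f T) :=
        card_lt_card (lt_of_le_of_ne (hmono S T hST.le) (hinj.ne hST.ne))
      have hS := hblue S
      have hT := hblue T
      unfold IsBlueSet at hS hT
      simp only [r]
      split_ifs <;> omega
    · intro S
      simp only [r]
      split_ifs <;> omega
  have hcoatom : ∀ i, #(f (univ.erase i)) = m + 1 ∧
      (residueSum (f (univ.erase i))).val < m - 1 := by
    intro i
    have h1 := hr (univ.erase i)
    have h2 := hblue (univ.erase i)
    rw [card_erase_of_mem (mem_univ i), card_univ, Fintype.card_fin] at h1
    unfold IsBlueSet at h2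
    simp only [r] at h1
    split_ifs at h1 <;> omega
  have hcard : ∀ i j, i ≠ j → #(f ((univ.erase i).erase j)) = m := by
    intro i j hij
    have h1 := hr ((univ.erase i).erase j)
    have h2 := hblue ((univ.erase i).erase j)
    rw [card_erase_of_mem (mem_erase.2 ⟨hij.symm, mem_univ j⟩), card_erase_of_mem (mem_univ i),
      card_univ, Fintype.card_fin] at h1
    unfold IsBlueSet at h2
    simp only [r] at h1
    split_ifs at h1 <;> omega
  -- Two of the `m` coatoms share a sum. Both extend the same `m`-set by one point, so equal sums
  -- make them equal.
  obtain ⟨i, -, j, -, hij, hsum⟩ := exists_ne_map_eq_of_card_lt_of_maps_to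
    (s := (univ : Finset (Fin m))) (t := range (m - 1))
    (f := fun i => (residueSum (f (univ.erase i))).val)
    (by rw [card_range, card_univ, Fintype.card_fin]; omega)
    (fun i _ => mem_coe.2 (mem_range.2 (hcoatom i).2))
  have hsum' := ZMod.val_injective _ hsum
  have hG := hcard i j hij
  obtain ⟨x, hx, hfx⟩ := exists_eq_insert_iff.2
    ⟨hmono _ _ (erase_subset j (univ.erase i)), by rw [hG, (hcoatom i).1]⟩
  obtain ⟨y, hy, hfy⟩ := exists_eq_insert_iff.2
    ⟨hmono ((univ.erase i).erase j) (univ.erase j) (by rw [erase_right_comm]; exact erase_subset i (univ.erase j)),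
      by rw [hG, (hcoatom j).1]⟩
  rw [← hfx, ← hfy, residueSum_insert hx, residueSum_insert hy] at hsum'
  have hxy : x = y := natCast_fin_injective _ (add_right_cancel hsum')
  have hij' := hinj (hfx.symm.trans ((congrArg (fun z => insert z _) hxy).trans hfy))
  have : i ∈ univ.erase j := mem_erase.2 ⟨hij, mem_univ i⟩
  rw [← hij'] at this
  exact notMem_erase i univ this

/-- The sizes of the sets in a weak copy of the Boolean lattice of dimension `n` that avoids
the blue sets. -/
theorem card_of_weakCopy_red {m n : ℕ} (hm : 2 ≤ m) (hn : 4 ≤ n)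
    {f : BooleanLattice n → BooleanLattice (m + n)} (hinj : Function.Injective f)
    (hmono : Monotone f) (hf : ∀ S, ¬ IsBlueSet m n (f S)) (S : Finset (Fin n)) :
    (#S = 0 → #(f S) + 2 = m) ∧ (#S = 1 → #(f S) + 1 = m) ∧ (#S = 2 → #(f S) = m + 1) ∧
      (#S = 3 → #(f S) = m + 2) ∧ (4 ≤ #S → #(f S) = m + #S) := by
  -- Numbers the layers meeting red, `m - 2, m - 1, m + 1, m + 2, m + 4, …, m + n`, from `0` to `n`.
  let r : ℕ → ℕ := fun s =>
    if s < m then s + 2 - m else if s ≤ m + 2 then s + 1 - m else s - m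
  have hr : r #(f S) = #S := by
    refine eq_card_of_strictMono (h := fun S => r #(f S)) ?_ ?_ S
    · intro S T hST
      have hlt : #(f S) < #(f T) := card_lt_card (hmono.strictMono_of_injective hinj hST)
      have hS := hf S
      have hT := hf T
      unfold IsBlueSet at hS hT
      simp only [r]
      split_ifs <;> omega
    · intro S
      have h1 : #(f S) ≤ m + n := (card_le_univ _).trans (Fintype.card_fin _).le
      simp only [r]
      split_ifs <;> omega
  have hS := hf S
  unfold IsBlueSet at hS
  simp only [r] at hr
  split_ifs at hr <;> omega

/-- A weak copy of a Boolean lattice that avoids the blue sets is, on the pairs of a large set of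
atoms, of the form `{i, j} ↦ A ∪ {φ i, φ j, e}`. -/
theorem exists_pairs_of_weakCopy_red {m n : ℕ} (hm : 2 ≤ m) (hn : 5 ≤ n)
    {f : BooleanLattice n → BooleanLattice (m + n)} (hinj : Function.Injective f)
    (hmono : Monotone f) (hf : ∀ S, ¬ IsBlueSet m n (f S)) :
    ∃ (A : Finset (Fin (m + n))) (φ : Fin n → Fin (m + n)) (J : Finset (Fin n))
      (e : Fin (m + n)), Function.Injective φ ∧ (∀ i, φ i ∉ A) ∧ n ≤ #J + 2 ∧ e ∉ A ∧
      (∀ i ∈ J, φ i ≠ e) ∧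
      ∀ i ∈ J, ∀ j ∈ J, i ≠ j → f {i, j} = insert e (insert (φ i) (insert (φ j) A)) := by
  classical
  have hcard := card_of_weakCopy_red hm (by omega) hinj hmono hf
  obtain ⟨A, hA⟩ : ∃ A, A = f ∅ := ⟨_, rfl⟩
  have hAcard : #A + 2 = m := by rw [hA]; exact (hcard ∅).1 rfl
  have hAsub : ∀ S, A ⊆ f S := fun S => hA ▸ hmono (empty_subset S)
  have hatom : ∀ i, ∃ x, x ∉ A ∧ insert x A = f {i} := by
    intro i
    refine exists_eq_insert_iff.2 ⟨hAsub _, ?_⟩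
    have := (hcard {i}).2.1 (card_singleton i)
    omega
  choose φ hφA hφ using hatom
  have hcoatom : ∀ i, ∃ x, x ∉ f (univ.erase i) ∧ insert x (f (univ.erase i)) = univ := by
    intro i
    refine exists_eq_insert_iff.2 ⟨subset_univ _, ?_⟩
    have h1 : #(univ.erase i) = n - 1 := by
      rw [card_erase_of_mem (mem_univ i), card_univ, Fintype.card_fin]
    have := (hcard (univ.erase i)).2.2.2.2 (by omega)
    rw [card_univ, Fintype.card_fin]
    omega
  -- `ψ i` is the single point missing from the image of the `i`-th coatom.
  choose ψ hψ hψ' using hcoatom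
  have hφmem : ∀ i S, i ∈ S → φ i ∈ f S := by
    intro i S hi
    apply hmono (singleton_subset_iff.2 hi)
    rw [← hφ]
    exact mem_insert_self _ _
  have hψnot : ∀ i S, i ∉ S → ψ i ∉ f S := fun i S hi h =>
    hψ i (hmono (subset_erase.2 ⟨subset_univ S, hi⟩) h)
  have hφinj : Function.Injective φ := by
    intro i j hij
    have : f {i} = f {j} := by rw [← hφ, ← hφ, hij]
    exact singleton_injective (hinj this)
  have hψinj : Function.Injective ψ := by
    intro i j hij
    by_contra hne
    have h1 : f (univ.erase i) = f (univ.erase j) := by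
      rw [← erase_insert (hψ i), ← erase_insert (hψ j), hψ', hψ', hij]
    have h2 : i ∈ univ.erase j := mem_erase.2 ⟨hne, mem_univ i⟩
    rw [← hinj h1] at h2
    exact notMem_erase i univ h2
  have hφψ : ∀ i j, i ≠ j → φ i ≠ ψ j := by
    intro i j hij h
    exact hψnot j {i} (by simpa using hij.symm) (h ▸ hφmem i {i} (mem_singleton_self i))
  have hψA : ∀ i, ψ i ∉ A := fun i => hA ▸ hψnot i ∅ (notMem_empty i)
  have hdisj : ∀ χ : Fin n → Fin (m + n), (∀ i, χ i ∉ A) → Disjoint A (univ.image χ) := by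
    intro χ hχ
    rw [Finset.disjoint_left]
    rintro x hx hx'
    obtain ⟨i, -, rfl⟩ := mem_image.1 hx'
    exact hχ i hx
  have hcardU : ∀ χ : Fin n → Fin (m + n), Function.Injective χ → (∀ i, χ i ∉ A) →
      #(A ∪ univ.image χ) + 2 = m + n := by
    intro χ hχ hχA
    rw [card_union_of_disjoint (hdisj χ hχA), card_image_of_injective _ hχ, card_univ,
      Fintype.card_fin]
    omega
  let J : Finset (Fin n) := {i | φ i = ψ i}
  have hJmem : ∀ i, i ∈ J ↔ φ i = ψ i := by simp [J]
  -- `A`, the image of `φ` and `ψ` of `Jᶜ` are disjoint, so `(m - 2) + n + #Jᶜ ≤ m + n`.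
  have hJ : n ≤ #J + 2 := by
    have h1 : Disjoint (A ∪ univ.image φ) (Jᶜ.image ψ) := by
      rw [Finset.disjoint_right]
      intro x hx hx'
      obtain ⟨j, hj, rfl⟩ := mem_image.1 hx
      rw [mem_compl, hJmem] at hj
      rcases mem_union.1 hx' with h | h
      · exact hψA j h
      · obtain ⟨i, -, h⟩ := mem_image.1 h
        rcases eq_or_ne i j with rfl | hij
        · exact hj h
        · exact hφψ i j hij h
    have h2 := card_le_univ ((A ∪ univ.image φ) ∪ Jᶜ.image ψ)
    rw [card_union_of_disjoint h1, card_image_of_injective _ hψinj, Fintype.card_fin] at h2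
    have h3 := hcardU φ hφinj hφA
    have h4 := card_add_card_compl J
    rw [Fintype.card_fin] at h4
    omega
  have hpair : ∀ i ∈ J, ∀ j ∈ J, i ≠ j → ∃ e, e ∉ A ∧ (∀ k ∈ J, φ k ≠ e) ∧
      f {i, j} = insert e (insert (φ i) (insert (φ j) A)) := by
    intro i hi j hj hij
    have hsub : insert (φ i) (insert (φ j) A) ⊆ f {i, j} := by
      refine insert_subset (hφmem _ _ (by simp)) (insert_subset (hφmem _ _ (by simp)) (hAsub _))
    have hc : #(insert (φ i) (insert (φ j) A)) = #A + 2 := by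
      rw [card_insert_of_notMem, card_insert_of_notMem (hφA j)]
      rw [mem_insert, not_or]
      exact ⟨hφinj.ne hij, hφA i⟩
    have hfc := (hcard {i, j}).2.2.1 (card_pair hij)
    obtain ⟨e, he, hfe⟩ := exists_eq_insert_iff.2 ⟨hsub, by omega⟩
    simp only [mem_insert, not_or] at he
    refine ⟨e, he.2.2, ?_, hfe.symm⟩
    -- For `k ∈ J` the point `φ k = ψ k` is missing from every image of a set avoiding `k`.
    rintro k hk rfl
    have hki : k ≠ i := fun h => he.1 (by rw [h])
    have hkj : k ≠ j := fun h => he.2.1 (by rw [h])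
    refine hψnot k {i, j} (by simp [hki, hkj]) ?_
    rw [← (hJmem k).1 hk, ← hfe]
    exact mem_insert_self _ _
  -- Different extra points would put `m + 3` elements into the image of `{i, j, k}`, which has only
  -- `m + 2`.
  have hadj : ∀ i ∈ J, ∀ j ∈ J, ∀ k ∈ J, i ≠ j → i ≠ k → j ≠ k → ∀ e e',
      e ∉ A → (∀ k ∈ J, φ k ≠ e) → f {i, j} = insert e (insert (φ i) (insert (φ j) A)) →
      e' ∉ A → (∀ k ∈ J, φ k ≠ e') → f {i, k} = insert e' (insert (φ i) (insert (φ k) A)) →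
      e' = e := by
    intro i hi j hj k hk hij hik hjk e e' heA hφe hfe heA' hφe' hfe'
    by_contra hne
    have hsub : insert e' (insert e (insert (φ i) (insert (φ j) (insert (φ k) A)))) ⊆
        f {i, j, k} := by
      refine insert_subset ?_ (insert_subset ?_ (insert_subset (hφmem _ _ (by simp))
        (insert_subset (hφmem _ _ (by simp)) (insert_subset (hφmem _ _ (by simp)) (hAsub _)))))
      · have h1 : f {i, k} ⊆ f {i, j, k} := hmono (insert_subset_insert i (subset_insert j {k}))
        exact h1 (hfe' ▸ mem_insert_self _ _)
      · have h1 : f {i, j} ⊆ f {i, j, k} := hmono (insert_subset_insert i (by simp))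
        exact h1 (hfe ▸ mem_insert_self _ _)
    have h1 := card_le_card hsub
    have h2 := (hcard {i, j, k}).2.2.2.1 (card_eq_three.2 ⟨i, j, k, hij, hik, hjk, rfl⟩)
    rw [card_insert_of_notMem, card_insert_of_notMem, card_insert_of_notMem,
      card_insert_of_notMem, card_insert_of_notMem (hφA k)] at h1
    · omega
    · simp [hφinj.ne hjk, hφA]
    · simp [hφinj.ne hij, hφinj.ne hik, hφA]
    · simp [(hφe i hi).symm, (hφe j hj).symm, (hφe k hk).symm, heA]
    · simp [hne, (hφe' i hi).symm, (hφe' j hj).symm, (hφe' k hk).symm, heA']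
  obtain ⟨i₀, hi₀, j₀, hj₀, hij₀⟩ := one_lt_card.1 (show 1 < #J by omega)
  obtain ⟨e, heA, hφe, hfe⟩ := hpair i₀ hi₀ j₀ hj₀ hij₀
  refine ⟨A, φ, J, e, hφinj, hφA, hJ, heA, hφe, ?_⟩
  have hstar : ∀ j ∈ J, i₀ ≠ j → f {i₀, j} = insert e (insert (φ i₀) (insert (φ j) A)) := by
    intro j hj hij
    rcases eq_or_ne j j₀ with rfl | hjj
    · exact hfe
    · obtain ⟨e', heA', hφe', hfe'⟩ := hpair i₀ hi₀ j hj hij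
      rwa [hadj i₀ hi₀ j₀ hj₀ j hj hij₀ hij hjj.symm e e' heA hφe hfe heA' hφe' hfe'] at hfe'
  have hstar' : ∀ i ∈ J, i₀ ≠ i → f {i, i₀} = insert e (insert (φ i) (insert (φ i₀) A)) := by
    intro i hi hi0
    rw [pair_comm, hstar i hi hi0, insert_comm (φ i₀)]
  -- Any other pair shares an atom with a pair through `i₀`, hence has the same extra point.
  intro i hi j hj hij
  rcases eq_or_ne i₀ i with rfl | hii
  · exact hstar j hj hij
  rcases eq_or_ne i₀ j with rfl | hjj
  · exact hstar' i hi hii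
  obtain ⟨e', heA', hφe', hfe'⟩ := hpair i hi j hj hij
  rwa [hadj i hi i₀ hi₀ j hj hii.symm hij hjj e e' heA hφe (hstar' i hi hii) heA' hφe' hfe']
    at hfe'

theorem not_containsWeakCopy_red {m n : ℕ} (hm : 2 ≤ m) (hmn : m ≤ n) (hn : 68 ≤ n) :
    ¬ ContainsWeakCopy (BooleanLattice n) {A | ¬ IsBlueSet m n A} := by
  classical
  rintro ⟨f, hinj, hmono, hf⟩
  have hNZ : NeZero (m + n) := ⟨by omega⟩
  obtain ⟨A, φ, J, e, hφ, hφA, hJ, heA, hφe, hpair⟩ :=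
    exists_pairs_of_weakCopy_red hm (by omega) hinj hmono hf
  let Y : Finset (ZMod (m + n)) := J.image fun i => ((φ i : ℕ) : ZMod (m + n))
  have hY : #Y = #J :=
    card_image_of_injective _ ((natCast_fin_injective (m + n)).comp hφ)
  obtain ⟨y, hy, z, hz, hyz, hlt⟩ := exists_ne_add_val_lt_pred hm hmn hn Y (by omega)
    (((e : ℕ) : ZMod (m + n)) + residueSum A)
  obtain ⟨i, hi, rfl⟩ := mem_image.1 hy
  obtain ⟨j, hj, rfl⟩ := mem_image.1 hz
  have hij : i ≠ j := by
    rintro rfl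
    exact hyz rfl
  have h1 : φ i ∉ insert (φ j) A := by
    rw [mem_insert, not_or]
    exact ⟨hφ.ne hij, hφA i⟩
  have h2 : e ∉ insert (φ i) (insert (φ j) A) := by
    simp only [mem_insert, not_or]
    exact ⟨(hφe i hi).symm, (hφe j hj).symm, heA⟩
  have hsum : residueSum (f {i, j}) = ((e : ℕ) : ZMod (m + n)) + residueSum A +
      ((φ i : ℕ) : ZMod (m + n)) + ((φ j : ℕ) : ZMod (m + n)) := by
    rw [hpair i hi j hj hij, residueSum_insert h2, residueSum_insert h1,
      residueSum_insert (hφA j)]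
    ring
  refine hf {i, j} (Or.inr (Or.inr (Or.inr ⟨?_, by rwa [hsum]⟩)))
  exact (card_of_weakCopy_red hm (by omega) hinj hmono hf {i, j}).2.2.1 (card_pair hij)

theorem not_weakArrows_of_le {m n : ℕ} (hm : 2 ≤ m) (hmn : m ≤ n) (hn : 68 ≤ n) :
    ¬ WeakArrows (BooleanLattice m) (BooleanLattice n) (m + n) := by
  classical
  intro h
  rcases h fun A => if IsBlueSet m n A then Color.blue else Color.red with h | h
  · refine not_containsWeakCopy_blue (n := n) hm ?_
    simpa using h
  · refine not_containsWeakCopy_red hm hmn hn ?_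
    simpa using h

theorem not_weakArrows {m n : ℕ} (hm : 2 ≤ m) (hn : 68 ≤ n) :
    ¬ WeakArrows (BooleanLattice m) (BooleanLattice n) (m + n) := by
  rcases le_total m n with h | h
  · exact not_weakArrows_of_le hm h hn
  · intro h'
    -- For `n ≤ m`, exchange the colors and the roles of `m` and `n`.
    rw [add_comm] at h'
    exact not_weakArrows_of_le (by omega) h (by omega) h'.symm

theorem add_one_le_weakRamseyNumber {m n : ℕ} (hm : 2 ≤ m) (hn : 68 ≤ n) :
    m + n + 1 ≤ weakRamseyNumber (BooleanLattice m) (BooleanLattice n) := by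
  refine le_csInf ⟨_, weakArrows_booleanLattice m n⟩ fun N hN => ?_
  by_contra! hlt
  exact not_weakArrows hm hn (WeakArrows.mono (by omega) hN)

end PosetRamsey

theorem theorem2 :
    (∀ m n : ℕ, 2 ≤ m → 68 ≤ n →
      m + n + 1 ≤ PosetRamsey.weakRamseyNumber
        (PosetRamsey.BooleanLattice m) (PosetRamsey.BooleanLattice n)) ∧
    (∀ n : ℕ, 68 ≤ n →
      PosetRamsey.weakRamseyNumber
        (PosetRamsey.BooleanLattice 2) (PosetRamsey.BooleanLattice n) = n + 3) := by
  refine ⟨fun m n hm hn => PosetRamsey.add_one_le_weakRamseyNumber hm hn, fun n hn => ?_⟩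
  apply le_antisymm
  · exact Nat.sInf_le (PosetRamsey.weakArrows_booleanLattice 2 n)
  · have := PosetRamsey.add_one_le_weakRamseyNumber (m := 2) le_rfl hn
    omega
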